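/- Let $\mathcal X$ be a finite alphabet, $d\ge 1$, and let $\Theta\subseteq\mathbb R^d$ have nonempty interior, with $\Theta\setminus\operatorname{int}\Theta$ Lebesgue-null. For every $\theta\in\Theta$ let an $\mathcal X$-valued random process be given, and write $\mu^n_\theta(x^n)$ for the probability that its first $n$ characters are $x^n\in\mathcal X^n$. All logarithms are in base 2. Let $H^n(\theta)=\sum_{x^n}\mu^n_\theta(x^n)\log\frac1{\mu^n_\theta(x^n)}$, $$\mathcal I(\theta)_{ij}=\lim_{n\to\infty}\frac1{n\log e}\,E_\theta\Big\{\frac{\partial^2}{\partial\theta_i\partial\theta_j}\log\frac1{\mu^n_\theta(X^n)}\Big\},\qquad w_J(\theta)=\frac{|\mathcal I(\theta)|^{1/2}}{\int_\Theta|\mathcal I(\phi)|^{1/2}d\phi}\quad\text{(Jeffreys' prior on }\Theta).$$ Assume the following regularity conditions: (1) every $\theta\mapsto\mu_\theta^n(x^n)$ is twice differentiable in the interior of $\Theta$, and the limits defining $\mathcal I(\theta)$ exist there; (2) $\int_\Theta|\mathcal I(\phi)|^{1/2}d\phi<\infty$; (3) $\mathcal I(\theta)$ is nonsingular for every $\theta$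 in the interior of $\Theta$; (4) there are maximum likelihood estimators $\widehat\theta_n:\mathcal X^n\to\mathbb R^d$ (that is, $\widehat\theta_n(x^n)$ maximizes $\phi\mapsto\mu_\phi^n(x^n)$ over $\Theta$ whenever a maximizer exists) such that for every $\theta$ in the interior of $\Theta$, under $\mu_\theta$, $\sqrt n\,(\widehat\theta_n(X^n)-\theta)$ converges in distribution to $\mathcal N(0,\mathcal I(\theta)^{-1})$. Correlation model: for $t\ge0$ let $p^t$ be the joint law of $(\theta^{(1)},\theta^{(2)})$ obtained as follows. Draw $\theta$ from $w_J$, then $Z^t$ from $\mu^t_\theta$; given $Z^t$, let $\theta^{(1)},\theta^{(2)}$ be independent, each distributed according to the conditional law of $\theta$ given $Z^t$. Let $L^n$ be the set of functions $l:\mathcal X^n\to[0,\infty)$ with $\sum_{x^n}2^{-l(x^n)}\le1$, and let $L^{n,m}$ be the set of functions $l:\mathcal X^n\times\mathcal X^m\to[0,\infty)$ with $l(\cdot,y^m)\in L^n$ for every $y^m$. The average redundancies of universal compression without side information, and with side information of length $m$ at both the encoder and the decoder, are $$\underline R^n=\inf_{l\in L^n}\int_\Theta\Big(\sum_{x^n}\mu_\theta^n(x^n)l(x^n)-H^n(\theta)\Big)w_J(\theta)\,d\theta,$$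 $$\underline R^{n,m,t}=\inf_{l\in L^{n,m}}E_{(\theta^{(1)},\theta^{(2)})\sim p^t}\Big\{\sum_{x^n,y^m}\mu^n_{\theta^{(1)}}(x^n)\,\mu^m_{\theta^{(2)}}(y^m)\,l(x^n,y^m)-H^n(\theta^{(1)})\Big\},$$ and the side information gain is $$g^{n,m,t}(\theta)=\frac{H^n(\theta)+\underline R^n}{H^n(\theta)+\underline R^{n,m,t}}.$$ Lemma. For all fixed integers $m,t\ge0$ and every $\theta\in\Theta$, $\displaystyle\lim_{n\to\infty}g^{n,m,t}(\theta)=1$. -/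

import Mathlib

open MeasureTheory ProbabilityTheory Filter Topology
open scoped BoundedContinuousFunction ENNReal

noncomputable section

/-- A parametric family of information sources on the alphabet `𝒳`: a `d`-dimensional parameter set
`Θ ⊆ ℝᵈ` and, for each `θ ∈ Θ`, the law of an `𝒳`-valued process. (Values of `law` outside `Θ` are
irrelevant.) That `Θ` is `d`-dimensional means that it has interior points, and that its points
which are not interior form a Lebesgue null set. -/
structure ParametricSource (d : ℕ) (𝒳 : Type*) [MeasurableSpace 𝒳] where
  Θ : Set (EuclideanSpace ℝ (Fin d))
  law : EuclideanSpace ℝ (Fin d) → Measure (ℕ → 𝒳)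
  isProbabilityMeasure_law : ∀ θ ∈ Θ, IsProbabilityMeasure (law θ)
  interior_nonempty : (interior Θ).Nonempty
  volume_diff_interior : volume (Θ \ interior Θ) = 0

namespace ParametricSource

variable {d : ℕ} {𝒳 : Type*} [MeasurableSpace 𝒳] (S : ParametricSource d 𝒳)

/-- `μ_θ^n(xⁿ)`: the probability that the source with parameter `θ` emits `xⁿ` as its first
`n` characters. -/
def prob (n : ℕ) (θ : EuclideanSpace ℝ (Fin d)) (x : Fin n → 𝒳) : ℝ :=
  (S.law θ).real {ω | ∀ i : Fin n, ω i = x i}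

variable [Fintype 𝒳]

/-- The Shannon entropy `Hⁿ(θ)`, in bits. -/
def entropy (n : ℕ) (θ : EuclideanSpace ℝ (Fin d)) : ℝ :=
  ∑ x : Fin n → 𝒳, S.prob n θ x * Real.logb 2 (1 / S.prob n θ x)

/-- `∂²/∂θᵢ∂θⱼ log (1 / μ_θ^n(xⁿ))`. -/
def hessNegLog (n : ℕ) (x : Fin n → 𝒳) (i j : Fin d) (θ : EuclideanSpace ℝ (Fin d)) : ℝ :=
  fderiv ℝ (fun φ => fderiv ℝ (fun ψ => Real.logb 2 (1 / S.prob n ψ x)) φ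
    (EuclideanSpace.single j 1)) θ (EuclideanSpace.single i 1)

/-- The normalized expectation `(1 / (n log e)) E {∂²/∂θᵢ∂θⱼ log (1 / μ_θ^n(Xⁿ))}`. -/
def fisherApprox (n : ℕ) (i j : Fin d) (θ : EuclideanSpace ℝ (Fin d)) : ℝ :=
  1 / (n * Real.logb 2 (Real.exp 1)) * ∑ x : Fin n → 𝒳, S.prob n θ x * S.hessNegLog n x i j θ

/-- The Fisher information matrix `I(θ)`. -/
def fisher (θ : EuclideanSpace ℝ (Fin d)) : Matrix (Fin d) (Fin d) ℝ :=
  Matrix.of fun i j => limUnder atTop fun n : ℕ => S.fisherApprox n i j θ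

/-- The density of Jeffreys' prior on `Θ`. -/
def jeffreys (θ : EuclideanSpace ℝ (Fin d)) : ℝ :=
  √(S.fisher θ).det / ∫ φ in S.Θ, √(S.fisher φ).det

/-- Jeffreys' prior, as a measure on `ℝᵈ` carried by `Θ`. -/
def prior : Measure (EuclideanSpace ℝ (Fin d)) :=
  (volume.restrict S.Θ).withDensity fun θ => ENNReal.ofReal (S.jeffreys θ)

/-- The probability of `Z^t = z` when `θ` follows Jeffreys' prior. -/
def mixture (t : ℕ) (z : Fin t → 𝒳) : ℝ≥0∞ :=
  ∫⁻ θ, ENNReal.ofReal (S.prob t θ z) ∂S.prior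

/-- The conditional law of the parameter given `Z^t = z`, by Bayes' rule. -/
def posterior (t : ℕ) (z : Fin t → 𝒳) : Measure (EuclideanSpace ℝ (Fin d)) :=
  (S.mixture t z)⁻¹ • S.prior.withDensity fun θ => ENNReal.ofReal (S.prob t θ z)

/-- The joint law `p^t` of `(θ⁽¹⁾, θ⁽²⁾)`: given `Z^t`, the two parameters are independent, each with
the conditional law of the parameter given `Z^t`. -/
def jointPrior (t : ℕ) :
    Measure (EuclideanSpace ℝ (Fin d) × EuclideanSpace ℝ (Fin d)) :=
  ∑ z : Fin t → 𝒳, S.mixture t z • (S.posterior t z).prod (S.posterior t z)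

variable (𝒳) in
/-- `Lⁿ`: the length functions on strings of length `n` which satisfy Kraft's inequality. -/
def lengths (n : ℕ) : Set ((Fin n → 𝒳) → ℝ) :=
  {l | (∀ x, 0 ≤ l x) ∧ ∑ x, (2 : ℝ) ^ (-l x) ≤ 1}

variable (𝒳) in
/-- `L^{n,m}`: the length functions with side information of length `m` at both encoder and decoder;
for each side information string the code satisfies Kraft's inequality. -/
def lengthsED (n m : ℕ) : Set ((Fin n → 𝒳) → (Fin m → 𝒳) → ℝ) :=
  {l | ∀ y, (fun x => l x y) ∈ lengths 𝒳 n}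

/-- `Rⁿ(l, θ)`: the expected redundancy of a length function without side information. -/
def redundancy (n : ℕ) (l : (Fin n → 𝒳) → ℝ) (θ : EuclideanSpace ℝ (Fin d)) : ℝ :=
  ∑ x, S.prob n θ x * l x - S.entropy n θ

/-- `R^{n,m}(l, θ⁽¹⁾, θ⁽²⁾)`: the expected redundancy of a length function with side information,
where given the parameters the strings `Xⁿ` and `Y^m` are independent. -/
def redundancyED (n m : ℕ) (l : (Fin n → 𝒳) → (Fin m → 𝒳) → ℝ)
    (θ₁ θ₂ : EuclideanSpace ℝ (Fin d)) : ℝ :=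
  ∑ x, ∑ y, S.prob n θ₁ x * S.prob m θ₂ y * l x y - S.entropy n θ₁

/-- The average redundancy of universal compression without side information, under Jeffreys'
prior. -/
def avgRedundancy (n : ℕ) : ℝ :=
  ⨅ l : lengths 𝒳 n, ∫ θ, S.redundancy n l θ ∂S.prior

/-- The average redundancy `R^{n,m,t}` of universal compression with side information at both
encoder and decoder. -/
def avgRedundancyED (n m t : ℕ) : ℝ :=
  ⨅ l : lengthsED 𝒳 n m, ∫ p, S.redundancyED n m l p.1 p.2 ∂S.jointPrior t

/-- The side information gain `g^{n,m,t}(θ)`. -/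
def gain (n m t : ℕ) (θ : EuclideanSpace ℝ (Fin d)) : ℝ :=
  (S.entropy n θ + S.avgRedundancy n) / (S.entropy n θ + S.avgRedundancyED n m t)

/-- `T` is a maximum likelihood estimator of the parameter from strings of length `n`: wherever the
likelihood attains a maximum over `Θ`, the value of `T` is a maximizer. -/
def IsMLE (n : ℕ) (T : (Fin n → 𝒳) → EuclideanSpace ℝ (Fin d)) : Prop :=
  ∀ x, (∃ θ ∈ S.Θ, IsMaxOn (fun φ => S.prob n φ x) S.Θ θ) →
    T x ∈ S.Θ ∧ IsMaxOn (fun φ => S.prob n φ x) S.Θ (T x)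

/-- The regularity conditions on the parametric family. -/
structure Regular : Prop where
  /-- The likelihoods are differentiable in the interior of `Θ`. -/
  differentiable : ∀ (n : ℕ) (x : Fin n → 𝒳),
    DifferentiableOn ℝ (fun θ => S.prob n θ x) (interior S.Θ)
  /-- The likelihoods are twice differentiable in the interior of `Θ`. -/
  differentiable_fderiv : ∀ (n : ℕ) (x : Fin n → 𝒳),
    DifferentiableOn ℝ (fderiv ℝ fun θ => S.prob n θ x) (interior S.Θ)
  /-- The limits that define the Fisher information matrix exist. -/
  fisher_exists : ∀ θ ∈ interior S.Θ, ∀ i j : Fin d,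
    ∃ L : ℝ, Tendsto (fun n : ℕ => S.fisherApprox n i j θ) atTop (𝓝 L)
  /-- The normalization constant of Jeffreys' prior is finite. -/
  integrable : IntegrableOn (fun θ => √(S.fisher θ).det) S.Θ
  /-- The Fisher information matrix is nonsingular. -/
  isUnit_fisher : ∀ θ ∈ interior S.Θ, IsUnit (S.fisher θ)
  /-- The central limit theorem for the maximum likelihood estimator: under each `θ` in the interior
  of `Θ`, `√n (T(Xⁿ) - θ)` converges in distribution to a centred normal vector with covariance
  matrix `I(θ)⁻¹`. -/
  clt : ∃ T : (n : ℕ) → (Fin n → 𝒳) → EuclideanSpace ℝ (Fin d),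
    (∀ n, S.IsMLE n (T n)) ∧
    ∀ θ ∈ interior S.Θ, ∀ f : EuclideanSpace ℝ (Fin d) →ᵇ ℝ,
      Tendsto (fun n : ℕ => ∑ x : Fin n → 𝒳, S.prob n θ x * f (√(n : ℝ) • (T n x - θ))) atTop
        (𝓝 (∫ v, f v ∂(multivariateGaussian 0 (S.fisher θ)⁻¹)))

end ParametricSource

end

/-! Side information of fixed length can save only a bounded number of bits, while the redundancy
without it tends to infinity; the ratio therefore tends to 1.

Bounded saving: averaging the subprobabilities `2 ^ (-l x y)` over `y` gives a code without side
information that is worse by at most `log |𝒳^m|` (`exists_lengths_le_add`). Conversely a code may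
ignore `y`. Both marginals of `p^t` are Jeffreys' prior, so the two average redundancies differ by
at most that constant, whatever `t` is.

Divergence (`tendsto_avgRedundancy`): the average redundancy is at least the prior average of the
divergence of `μ_θ^n` from the Bayes mixture. The central limit theorem makes the estimator
consistent. Hence the event that it falls near `θ` has probability tending to 1 under `μ_θ`, but
small probability under the mixture, because the prior has no atoms. Each divergence thus tends to
infinity, and Fatou's lemma passes this to the average.

That Jeffreys' prior is a probability measure rests on `det_fisher_pos`: the information matrix is a
limit of positive semidefinite matrices and is nonsingular. -/

set_option linter.unusedSectionVars false

/-! ### Second derivatives of likelihoods -/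

section SecondDerivative

variable {E : Type*} [NormedAddCommGroup E] [NormedSpace ℝ E]

theorem fderiv_fderiv_logb_inv {p : E → ℝ} {θ : E}
    (h₁ : ∀ᶠ φ in 𝓝 θ, DifferentiableAt ℝ p φ) (h₂ : DifferentiableAt ℝ (fderiv ℝ p) θ)
    (hp : 0 < p θ) (u v : E) :
    fderiv ℝ (fun φ => fderiv ℝ (fun ψ => Real.logb 2 (1 / p ψ)) φ v) θ u =
      (Real.log 2)⁻¹ *
        ((p θ ^ 2)⁻¹ * (fderiv ℝ p θ u * fderiv ℝ p θ v) -
          (p θ)⁻¹ * fderiv ℝ (fderiv ℝ p) θ u v) := by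
  have hd : DifferentiableAt ℝ p θ := h₁.self_of_nhds
  have hpos : ∀ᶠ φ in 𝓝 θ, 0 < p φ := hd.continuousAt.eventually (lt_mem_nhds hp)
  have hev : (fun φ => fderiv ℝ (fun ψ => Real.logb 2 (1 / p ψ)) φ v) =ᶠ[𝓝 θ]
      fun φ => -(Real.log 2)⁻¹ * ((p φ)⁻¹ * fderiv ℝ p φ v) := by
    filter_upwards [h₁, hpos] with φ hφ hφ0
    have h : HasFDerivAt (fun ψ => -(Real.log 2)⁻¹ * Real.log (p ψ))
        (-(Real.log 2)⁻¹ • ((p φ)⁻¹ • fderiv ℝ p φ)) φ :=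
      (hφ.hasFDerivAt.log hφ0.ne').const_mul _
    have he : (fun ψ => Real.logb 2 (1 / p ψ)) = fun ψ => -(Real.log 2)⁻¹ * Real.log (p ψ) := by
      funext ψ
      rw [Real.logb, one_div, Real.log_inv]
      ring
    rw [he, h.fderiv]
    simp
  have hinv : HasFDerivAt (fun φ => (p φ)⁻¹) (-(p θ ^ 2)⁻¹ • fderiv ℝ p θ) θ :=
    (hasDerivAt_inv hp.ne').comp_hasFDerivAt θ hd.hasFDerivAt
  have hv : HasFDerivAt (fun φ => fderiv ℝ p φ v)
      ((fderiv ℝ (fderiv ℝ p) θ).flip v) θ := by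
    have := h₂.hasFDerivAt.clm_apply (hasFDerivAt_const v θ)
    simpa using this
  have hmul : HasFDerivAt (fun φ => -(Real.log 2)⁻¹ * ((p φ)⁻¹ * fderiv ℝ p φ v)) _ θ :=
    (hinv.mul hv).const_mul _
  rw [hev.fderiv_eq, hmul.fderiv]
  simp
  ring

/-- On a line through `θ`, a negative second derivative would make the point a local maximum as
well. The restriction would then be locally constant, with second derivative 0. -/
theorem fderiv_fderiv_nonneg_of_isLocalMin {p : E → ℝ} {θ : E}
    (h₁ : ∀ᶠ φ in 𝓝 θ, DifferentiableAt ℝ p φ) (h₂ : DifferentiableAt ℝ (fderiv ℝ p) θ)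
    (hmin : IsLocalMin p θ) (v : E) : 0 ≤ fderiv ℝ (fderiv ℝ p) θ v v := by
  set g : ℝ → ℝ := fun s => p (θ + s • v) with hg
  have hline : ∀ s : ℝ, HasDerivAt (fun s : ℝ => θ + s • v) v s := fun s => by
    simpa using ((hasDerivAt_id s).smul_const v).const_add θ
  have hcont : Tendsto (fun s : ℝ => θ + s • v) (𝓝 0) (𝓝 θ) := by
    simpa using (hline 0).continuousAt.tendsto
  have hgd : ∀ᶠ s in 𝓝 (0 : ℝ), HasDerivAt g (fderiv ℝ p (θ + s • v) v) s := by
    filter_upwards [hcont.eventually h₁] with s hs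
    exact hs.hasFDerivAt.comp_hasDerivAt s (hline s)
  have hgd' : deriv g =ᶠ[𝓝 0] fun s => fderiv ℝ p (θ + s • v) v :=
    hgd.mono fun s hs => hs.deriv
  have hgmin : IsLocalMin g 0 := by
    filter_upwards [hcont.eventually hmin] with s hs
    simpa [hg] using hs
  have hg2 : deriv (deriv g) 0 = fderiv ℝ (fderiv ℝ p) θ v v := by
    rw [hgd'.deriv_eq]
    have h3 : HasFDerivAt (fderiv ℝ p) (fderiv ℝ (fderiv ℝ p) θ) (θ + (0 : ℝ) • v) := by
      simpa using h₂.hasFDerivAt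
    have h4 := h3.comp_hasDerivAt (0 : ℝ) (hline 0)
    have h5 := h4.clm_apply (hasDerivAt_const (0 : ℝ) v)
    simpa using h5.deriv
  rw [← hg2]
  by_contra! hneg
  have hmax := isLocalMax_of_deriv_deriv_neg hneg hgmin.deriv_eq_zero
    hgd.self_of_nhds.continuousAt
  have hconst : g =ᶠ[𝓝 0] fun _ => g 0 := by
    filter_upwards [hgmin, hmax] with s h h' using le_antisymm h' h
  have h0 : deriv (deriv g) 0 = 0 := by
    have : deriv g =ᶠ[𝓝 0] fun _ => 0 := by
      filter_upwards [hconst.eventually_nhds] with s hs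
      rw [EventuallyEq.deriv_eq hs, deriv_const]
    rw [this.deriv_eq, deriv_const]
  exact hneg.ne h0

theorem sum_fderiv_fderiv_eq_zero {ι : Type*} (s : Finset ι) {p : ι → E → ℝ} {θ : E} {c : ℝ}
    (h₁ : ∀ x ∈ s, ∀ᶠ φ in 𝓝 θ, DifferentiableAt ℝ (p x) φ)
    (h₂ : ∀ x ∈ s, DifferentiableAt ℝ (fderiv ℝ (p x)) θ)
    (hc : ∀ᶠ φ in 𝓝 θ, ∑ x ∈ s, p x φ = c) :
    ∑ x ∈ s, fderiv ℝ (fderiv ℝ (p x)) θ = 0 := by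
  rw [← fderiv_fun_sum h₂]
  have h : (fun φ => ∑ x ∈ s, fderiv ℝ (p x) φ) =ᶠ[𝓝 θ] fun _ => 0 := by
    filter_upwards [(Finset.eventually_all s).2 h₁, hc.eventually_nhds] with φ hφ hcφ
    rw [← fderiv_fun_sum hφ, EventuallyEq.fderiv_eq (f₁ := fun φ => ∑ x ∈ s, p x φ)
      (f := fun _ => c) hcφ]
    simp
  rw [h.fderiv_eq]
  simp

end SecondDerivative

/-! ### Positivity of the Fisher information, and Jeffreys' prior -/

theorem posSemidef_of_bilin {d : ℕ}
    (B : EuclideanSpace ℝ (Fin d) →L[ℝ] EuclideanSpace ℝ (Fin d) →L[ℝ] ℝ)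
    (hsymm : ∀ u v, B u v = B v u) (hB : ∀ v, 0 ≤ B v v) :
    (Matrix.of fun i j => B (EuclideanSpace.single i 1) (EuclideanSpace.single j 1)).PosSemidef := by
  refine Matrix.PosSemidef.of_dotProduct_mulVec_nonneg ?_ fun v => ?_
  · ext i j
    simpa using hsymm _ _
  · refine (hB (∑ i, v i • EuclideanSpace.single i (1 : ℝ))).trans_eq ?_
    simp only [map_sum, map_smul, sum_apply, smul_apply,
      dotProduct, Matrix.mulVec, Matrix.of_apply, smul_eq_mul, star_trivial, Finset.mul_sum]
    rw [Finset.sum_comm]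
    refine Finset.sum_congr rfl fun i _ => Finset.sum_congr rfl fun j _ => ?_
    ring

noncomputable section
namespace ParametricSource

variable {d : ℕ} {𝒳 : Type*} [MeasurableSpace 𝒳] {S : ParametricSource d 𝒳}

theorem prob_nonneg (S : ParametricSource d 𝒳) (n : ℕ) (θ : EuclideanSpace ℝ (Fin d))
    (x : Fin n → 𝒳) : 0 ≤ S.prob n θ x := measureReal_nonneg

variable [Fintype 𝒳] [DiscreteMeasurableSpace 𝒳]

theorem sum_prob {θ : EuclideanSpace ℝ (Fin d)} (hθ : θ ∈ S.Θ) (n : ℕ) :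
    ∑ x : Fin n → 𝒳, S.prob n θ x = 1 := by
  have := S.isProbabilityMeasure_law θ hθ
  have hf : Measurable fun (ω : ℕ → 𝒳) (i : Fin n) => ω i := by fun_prop
  have h := sum_measureReal_preimage_singleton (μ := S.law θ) (Finset.univ : Finset (Fin n → 𝒳))
    (f := fun (ω : ℕ → 𝒳) (i : Fin n) => ω i) fun y _ => hf (measurableSet_singleton y)
  simp only [Finset.coe_univ, Set.preimage_univ, probReal_univ] at h
  rw [← h]
  refine Finset.sum_congr rfl fun x _ => ?_
  rw [prob]
  congr 1
  ext ω
  simp [funext_iff]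

theorem prob_le_one {θ : EuclideanSpace ℝ (Fin d)} (hθ : θ ∈ S.Θ) (n : ℕ) (x : Fin n → 𝒳) :
    S.prob n θ x ≤ 1 := by
  rw [← sum_prob hθ n]
  exact Finset.single_le_sum (fun y _ => S.prob_nonneg n θ y) (Finset.mem_univ x)

namespace Regular

/-- The Hessians of the likelihoods sum to zero because the probabilities sum to 1, which leaves the
Gram form of the score. Strings of probability zero need separate care, since they have no score. -/
theorem det_fisherApprox_nonneg (hS : S.Regular) {θ : EuclideanSpace ℝ (Fin d)}
    (hθ : θ ∈ interior S.Θ) (n : ℕ) :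
    0 ≤ (Matrix.of fun i j => S.fisherApprox n i j θ).det := by
  classical
  set p : (Fin n → 𝒳) → EuclideanSpace ℝ (Fin d) → ℝ := fun x φ => S.prob n φ x
  have hmem : ∀ᶠ φ in 𝓝 θ, φ ∈ interior S.Θ := isOpen_interior.mem_nhds hθ
  have h₁ : ∀ x, ∀ᶠ φ in 𝓝 θ, DifferentiableAt ℝ (p x) φ := fun x =>
    hmem.mono fun φ hφ => (hS.differentiable n x).differentiableAt (isOpen_interior.mem_nhds hφ)
  have h₂ : ∀ x, DifferentiableAt ℝ (fderiv ℝ (p x)) θ := fun x =>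
    (hS.differentiable_fderiv n x).differentiableAt hmem
  have hsum : ∑ x, fderiv ℝ (fderiv ℝ (p x)) θ = 0 :=
    sum_fderiv_fderiv_eq_zero (c := 1) _ (fun x _ => h₁ x) (fun x _ => h₂ x)
      (hmem.mono fun φ hφ => sum_prob (interior_subset hφ) n)
  -- Where `p x θ = 0` the term of the expectation vanishes, so adding and subtracting the Hessian
  -- of `p x` is harmless. That Hessian is positive semidefinite because `p x ≥ 0` attains a minimum
  -- at `θ`.
  set B : (Fin n → 𝒳) → EuclideanSpace ℝ (Fin d) →L[ℝ] EuclideanSpace ℝ (Fin d) →L[ℝ] ℝ := fun x =>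
    if p x θ = 0 then fderiv ℝ (fderiv ℝ (p x)) θ
    else (p x θ)⁻¹ • (fderiv ℝ (p x) θ).smulRight (fderiv ℝ (p x) θ) with hBdef
  have hpsd : ∀ x, (Matrix.of fun i j =>
      B x (EuclideanSpace.single i 1) (EuclideanSpace.single j 1)).PosSemidef := by
    intro x
    apply posSemidef_of_bilin
    · intro u v
      by_cases h0 : p x θ = 0
      · simp only [hBdef, h0, if_true]
        exact second_derivative_symmetric_of_eventually
          ((h₁ x).mono fun φ hφ => hφ.hasFDerivAt) (h₂ x).hasFDerivAt u v
      · simp [hBdef, h0]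
        ring
    · intro v
      by_cases h0 : p x θ = 0
      · simp only [hBdef, h0, if_true]
        refine fderiv_fderiv_nonneg_of_isLocalMin (h₁ x) (h₂ x) (.of_forall fun φ => ?_) v
        rw [h0]
        exact S.prob_nonneg n φ x
      · simp only [hBdef, h0, if_false, smul_apply,
          ContinuousLinearMap.smulRight_apply, smul_eq_mul]
        exact mul_nonneg (inv_nonneg.2 (S.prob_nonneg n θ x)) (mul_self_nonneg _)
  have hterm : ∀ x i j, S.prob n θ x * S.hessNegLog n x i j θ =
      (Real.log 2)⁻¹ * (B x (EuclideanSpace.single i 1) (EuclideanSpace.single j 1) -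
        fderiv ℝ (fderiv ℝ (p x)) θ (EuclideanSpace.single i 1) (EuclideanSpace.single j 1)) := by
    intro x i j
    by_cases h0 : p x θ = 0
    · have h0' : S.prob n θ x = 0 := h0
      simp [hBdef, h0, h0']
    · have hpos : 0 < p x θ := lt_of_le_of_ne (S.prob_nonneg n θ x) (Ne.symm h0)
      rw [hessNegLog, fderiv_fderiv_logb_inv (h₁ x) (h₂ x) hpos]
      simp only [hBdef, h0, if_false, smul_apply,
          ContinuousLinearMap.smulRight_apply, smul_eq_mul]
      change p x θ * _ = _
      field_simp
  have hM : (Matrix.of fun i j => S.fisherApprox n i j θ) =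
      (1 / (n * Real.logb 2 (Real.exp 1)) * (Real.log 2)⁻¹) • ∑ x, Matrix.of fun i j =>
        B x (EuclideanSpace.single i 1) (EuclideanSpace.single j 1) := by
    ext i j
    have hz := congrArg (fun D => D (EuclideanSpace.single i 1) (EuclideanSpace.single j 1)) hsum
    simp only [sum_apply, zero_apply] at hz
    simp only [Matrix.of_apply, fisherApprox, hterm, Matrix.smul_apply, Matrix.sum_apply,
      smul_eq_mul, ← Finset.mul_sum, Finset.sum_sub_distrib, hz, sub_zero]
    ring
  rw [hM]
  refine Matrix.PosSemidef.det_nonneg ((Matrix.posSemidef_sum _ fun x _ => hpsd x).smul ?_)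
  rw [Real.logb, Real.log_exp]
  have : 0 < Real.log 2 := Real.log_pos one_lt_two
  positivity

theorem det_fisher_pos (hS : S.Regular) {θ : EuclideanSpace ℝ (Fin d)}
    (hθ : θ ∈ interior S.Θ) : 0 < (S.fisher θ).det := by
  have hlim : Tendsto (fun n => (Matrix.of fun i j => S.fisherApprox n i j θ).det) atTop
      (𝓝 (S.fisher θ).det) := by
    have hent : Tendsto (fun n => Matrix.of fun i j => S.fisherApprox n i j θ) atTop
        (𝓝 (S.fisher θ)) := by
      refine tendsto_pi_nhds.2 fun i => tendsto_pi_nhds.2 fun j => ?_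
      exact tendsto_nhds_limUnder (hS.fisher_exists θ hθ i j)
    exact (continuous_id.matrix_det.tendsto _).comp hent
  have h0 : 0 ≤ (S.fisher θ).det :=
    ge_of_tendsto' hlim fun n => hS.det_fisherApprox_nonneg hθ n
  have := (Matrix.isUnit_iff_isUnit_det _).1 (hS.isUnit_fisher θ hθ)
  exact lt_of_le_of_ne h0 this.ne_zero.symm

end Regular

theorem interior_ae_eq (S : ParametricSource d 𝒳) : interior S.Θ =ᵐ[volume] S.Θ := by
  refine (ae_le_set.2 ?_).antisymm (ae_le_set.2 S.volume_diff_interior)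
  rw [Set.sdiff_eq_empty.2 interior_subset, measure_empty]

/-- Regularity is assumed on the interior only; the null boundary part makes this enough for every
integral against the prior. -/
theorem ae_prior_mem (S : ParametricSource d 𝒳) : ∀ᵐ θ ∂S.prior, θ ∈ interior S.Θ := by
  refine (withDensity_absolutelyContinuous _ _).ae_le ?_
  rw [← Measure.restrict_congr_set S.interior_ae_eq]
  exact ae_restrict_mem isOpen_interior.measurableSet

/-- Here `d ≥ 1` matters: Lebesgue measure has no atoms. -/
theorem prior_singleton (hd : 1 ≤ d) (S : ParametricSource d 𝒳) (θ : EuclideanSpace ℝ (Fin d)) :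
    S.prior {θ} = 0 := by
  have : Nonempty (Fin d) := ⟨⟨0, hd⟩⟩
  refine withDensity_absolutelyContinuous _ _ ?_
  exact Measure.absolutelyContinuous_of_le Measure.restrict_le_self (measure_singleton θ)

namespace Regular

theorem isProbabilityMeasure_prior (hS : S.Regular) : IsProbabilityMeasure S.prior := by
  have hpos : 0 < ∫ φ in S.Θ, √(S.fisher φ).det := by
    rw [setIntegral_pos_iff_support_of_nonneg_ae (.of_forall fun _ => Real.sqrt_nonneg _)
      hS.integrable]
    refine (isOpen_interior.measure_pos volume S.interior_nonempty).trans_le (measure_mono ?_)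
    exact fun θ hθ => ⟨(Real.sqrt_pos.2 (hS.det_fisher_pos hθ)).ne', interior_subset hθ⟩
  constructor
  rw [prior, withDensity_apply _ MeasurableSet.univ, Measure.restrict_univ]
  unfold jeffreys
  rw [← ofReal_integral_eq_lintegral_ofReal (hS.integrable.div_const _)
    (.of_forall fun _ => div_nonneg (Real.sqrt_nonneg _) hpos.le), integral_div,
    div_self hpos.ne', ENNReal.ofReal_one]

theorem aestronglyMeasurable_prob (hS : S.Regular) (n : ℕ) (x : Fin n → 𝒳) :
    AEStronglyMeasurable (fun θ => S.prob n θ x) S.prior := by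
  refine AEStronglyMeasurable.mono_ac (withDensity_absolutelyContinuous _ _) ?_
  rw [← Measure.restrict_congr_set S.interior_ae_eq]
  exact (hS.differentiable n x).continuousOn.aestronglyMeasurable isOpen_interior.measurableSet

theorem integrable_prob (hS : S.Regular) (n : ℕ) (x : Fin n → 𝒳) :
    Integrable (fun θ => S.prob n θ x) S.prior := by
  have := hS.isProbabilityMeasure_prior
  refine .of_bound (hS.aestronglyMeasurable_prob n x) 1 ?_
  filter_upwards [S.ae_prior_mem] with θ hθ
  rw [Real.norm_of_nonneg (S.prob_nonneg n θ x)]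
  exact prob_le_one (interior_subset hθ) n x

end Regular
end ParametricSource
end

/-! ### Gibbs' inequality and a lower bound for the divergence -/

section Gibbs

variable {ι : Type*} [Fintype ι]

/-- From `log u ≤ u - 1`. Absolute continuity must be assumed because `logb 2 (1 / 0)` is 0 here and
not infinite. -/
theorem sum_mul_logb_inv_le {p q : ι → ℝ} (hp : ∀ x, 0 ≤ p x) (hq : ∀ x, 0 ≤ q x)
    (hp1 : ∑ x, p x = 1) (hq1 : ∑ x, q x ≤ 1) (hpq : ∀ x, q x = 0 → p x = 0) :
    ∑ x, p x * Real.logb 2 (1 / p x) ≤ ∑ x, p x * Real.logb 2 (1 / q x) := by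
  have hlog : 0 < Real.log 2 := Real.log_pos one_lt_two
  have hterm : ∀ x, p x * Real.logb 2 (1 / p x) - p x * Real.logb 2 (1 / q x) ≤
      (q x - p x) / Real.log 2 := by
    intro x
    rcases (hp x).eq_or_lt with h0 | h0
    · rw [← h0]
      simpa using div_nonneg (hq x) hlog.le
    · have hqx : 0 < q x := lt_of_le_of_ne (hq x) fun h => h0.ne' (hpq x h.symm)
      rw [Real.logb, Real.logb, one_div, one_div, Real.log_inv, Real.log_inv, ← mul_sub, ← sub_div,
        ← mul_div_assoc]
      refine div_le_div_of_nonneg_right ?_ hlog.le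
      have h := Real.log_le_sub_one_of_pos (div_pos hqx h0)
      rw [Real.log_div hqx.ne' h0.ne'] at h
      calc p x * (-Real.log (p x) - -Real.log (q x))
          = p x * (Real.log (q x) - Real.log (p x)) := by ring
        _ ≤ p x * (q x / p x - 1) := mul_le_mul_of_nonneg_left h h0.le
        _ = q x - p x := by field_simp
  have h := Finset.sum_le_sum fun x (_ : x ∈ Finset.univ) => hterm x
  rw [Finset.sum_sub_distrib, ← Finset.sum_div, Finset.sum_sub_distrib, hp1] at h
  have : (∑ x, q x - 1) / Real.log 2 ≤ 0 := div_nonpos_of_nonpos_of_nonneg (by linarith) hlog.le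
  linarith

theorem sum_mul_logb_inv_le_of_kraft {p l : ι → ℝ} (hp : ∀ x, 0 ≤ p x) (hp1 : ∑ x, p x = 1)
    (hl : ∑ x, (2 : ℝ) ^ (-l x) ≤ 1) :
    ∑ x, p x * Real.logb 2 (1 / p x) ≤ ∑ x, p x * l x := by
  have hpos : ∀ x, 0 < (2 : ℝ) ^ (-l x) := fun x => Real.rpow_pos_of_pos two_pos _
  refine (sum_mul_logb_inv_le hp (fun x => (hpos x).le) hp1 hl
    fun x h => absurd h (hpos x).ne').trans_eq ?_
  refine Finset.sum_congr rfl fun x _ => ?_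
  rw [one_div, ← Real.rpow_neg two_pos.le, neg_neg, Real.logb_rpow two_pos (by norm_num)]

/-- If `A` is rare under `q`, a code for `q` wastes bits on `A`. Gibbs' inequality is applied to a
subprobability `r` that puts more weight on `A`. -/
theorem mul_logb_inv_sub_one_le [DecidableEq ι] {p q : ι → ℝ} (hp : ∀ x, 0 ≤ p x)
    (hq : ∀ x, 0 ≤ q x) (hp1 : ∑ x, p x = 1) (hq1 : ∑ x, q x ≤ 1) (hpq : ∀ x, q x = 0 → p x = 0)
    (A : Finset ι) {ε : ℝ} (hε : 0 < ε) (hA : ∑ x ∈ A, q x ≤ ε) :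
    (∑ x ∈ A, p x) * Real.logb 2 (1 / ε) - 1 ≤
      ∑ x, p x * Real.logb 2 (1 / q x) - ∑ x, p x * Real.logb 2 (1 / p x) := by
  -- Each half of `r` has mass at most 1/2. Replacing `q` by `r` costs one bit everywhere and
  -- regains `log (1 / ε)` bits on `A`.
  set r : ι → ℝ := fun x => (if x ∈ A then q x / (2 * ε) else 0) + (if x ∈ A then 0 else q x / 2)
    with hr
  have hr0 : ∀ x, 0 ≤ r x := fun x => by
    have := hq x
    by_cases h : x ∈ A <;> simp [hr, h] <;> positivity
  have hr1 : ∑ x, r x ≤ 1 := by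
    have h1 : ∑ x, (if x ∈ A then q x / (2 * ε) else 0) ≤ 1 / 2 := by
      rw [← Finset.sum_filter, Finset.filter_mem_eq_inter, Finset.univ_inter, ← Finset.sum_div,
        div_le_iff₀ (by positivity)]
      linarith
    have h2 : ∑ x, (if x ∈ A then 0 else q x / 2) ≤ 1 / 2 := by
      calc ∑ x, (if x ∈ A then 0 else q x / 2) ≤ ∑ x, q x / 2 := by
            refine Finset.sum_le_sum fun x _ => ?_
            have := hq x
            split_ifs <;> linarith
        _ ≤ 1 / 2 := by
            rw [← Finset.sum_div]
            linarith
    rw [hr, Finset.sum_add_distrib]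
    linarith
  have hpr : ∀ x, r x = 0 → p x = 0 := by
    intro x h
    refine hpq x ?_
    by_cases hx : x ∈ A
    · simpa [hr, hx, hε.ne'] using h
    · simpa [hr, hx] using h
  have hterm : ∀ x, p x * Real.logb 2 (1 / r x) =
      p x * Real.logb 2 (1 / q x) + p x - (if x ∈ A then p x * Real.logb 2 (1 / ε) else 0) := by
    intro x
    rcases eq_or_ne (p x) 0 with h0 | h0
    · simp [h0]
    · have hqx : q x ≠ 0 := fun h => h0 (hpq x h)
      have h2 : Real.logb 2 2 = 1 := Real.logb_self_eq_one one_lt_two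
      by_cases hx : x ∈ A
      · have : Real.logb 2 (1 / r x) = Real.logb 2 (1 / q x) + 1 - Real.logb 2 (1 / ε) := by
          simp only [hr, hx, if_true, add_zero, one_div, Real.logb_inv]
          rw [Real.logb_div hqx (by positivity), Real.logb_mul two_ne_zero hε.ne', h2]
          ring
        rw [this, if_pos hx]
        ring
      · have : Real.logb 2 (1 / r x) = Real.logb 2 (1 / q x) + 1 := by
          simp only [hr, hx, if_false, zero_add, one_div, Real.logb_inv]
          rw [Real.logb_div hqx two_ne_zero, h2]
          ring
        rw [this, if_neg hx]
        ring
  have h := sum_mul_logb_inv_le hp hr0 hp1 hr1 hpr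
  simp only [hterm] at h
  rw [Finset.sum_sub_distrib, Finset.sum_add_distrib, hp1, ← Finset.sum_filter,
    Finset.filter_mem_eq_inter, Finset.univ_inter, ← Finset.sum_mul] at h
  linarith

theorem nonempty_kraft [Nonempty ι] :
    ∃ l : ι → ℝ, (∀ x, 0 ≤ l x) ∧ ∑ x, (2 : ℝ) ^ (-l x) ≤ 1 := by
  have hc : (1 : ℝ) ≤ Fintype.card ι := by exact_mod_cast Fintype.card_pos
  refine ⟨fun _ => Real.logb 2 (Fintype.card ι), fun _ => Real.logb_nonneg one_lt_two hc, ?_⟩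
  rw [Finset.sum_const, Finset.card_univ, nsmul_eq_mul, Real.rpow_neg two_pos.le,
    Real.rpow_logb two_pos (by norm_num) (by linarith)]
  exact (mul_inv_cancel₀ (by linarith)).le

end Gibbs

/-! ### Redundancy and the Bayes mixture -/

noncomputable section
namespace ParametricSource

variable {d : ℕ} {𝒳 : Type*} [MeasurableSpace 𝒳] {S : ParametricSource d 𝒳}
variable [Fintype 𝒳] [DiscreteMeasurableSpace 𝒳]

theorem redundancy_nonneg {n : ℕ} {l : (Fin n → 𝒳) → ℝ} (hl : l ∈ lengths 𝒳 n)
    {θ : EuclideanSpace ℝ (Fin d)} (hθ : θ ∈ S.Θ) : 0 ≤ S.redundancy n l θ :=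
  sub_nonneg.2 (sum_mul_logb_inv_le_of_kraft (S.prob_nonneg n θ) (sum_prob hθ n) hl.2)

theorem entropy_nonneg {θ : EuclideanSpace ℝ (Fin d)} (hθ : θ ∈ S.Θ) (n : ℕ) :
    0 ≤ S.entropy n θ := by
  refine Finset.sum_nonneg fun x _ => mul_nonneg (S.prob_nonneg n θ x) ?_
  rw [one_div, Real.logb_inv, neg_nonneg]
  exact Real.logb_nonpos one_lt_two (S.prob_nonneg n θ x) (prob_le_one hθ n x)

theorem entropy_le {θ : EuclideanSpace ℝ (Fin d)} (hθ : θ ∈ S.Θ) (n : ℕ)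
    {l : (Fin n → 𝒳) → ℝ} (hl : l ∈ lengths 𝒳 n) : S.entropy n θ ≤ ∑ x, l x :=
  (sum_mul_logb_inv_le_of_kraft (S.prob_nonneg n θ) (sum_prob hθ n) hl.2).trans <|
    Finset.sum_le_sum fun x _ => mul_le_of_le_one_left (hl.1 x) (prob_le_one hθ n x)

theorem nonempty_alphabet (S : ParametricSource d 𝒳) : Nonempty 𝒳 := by
  obtain ⟨θ, hθ⟩ := S.interior_nonempty
  have := S.isProbabilityMeasure_law θ (interior_subset hθ)
  obtain ⟨ω⟩ := (S.law θ).nonempty_of_neZero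
  exact ⟨ω 0⟩

theorem nonempty_lengths (S : ParametricSource d 𝒳) (n : ℕ) : (lengths 𝒳 n).Nonempty :=
  have := S.nonempty_alphabet
  nonempty_kraft

namespace Regular

theorem aestronglyMeasurable_entropy (hS : S.Regular) (n : ℕ) :
    AEStronglyMeasurable (S.entropy n) S.prior := by
  unfold entropy
  refine Finset.aestronglyMeasurable_fun_sum _ fun x _ => ?_
  have h := (hS.aestronglyMeasurable_prob n x).aemeasurable
  simp only [Real.logb]
  exact (h.mul
    ((Real.measurable_log.comp_aemeasurable (h.const_div 1)).div_const _)).aestronglyMeasurable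

theorem integrable_entropy (hS : S.Regular) (n : ℕ) : Integrable (S.entropy n) S.prior := by
  have := hS.isProbabilityMeasure_prior
  obtain ⟨l, hl⟩ := S.nonempty_lengths n
  refine .of_bound (hS.aestronglyMeasurable_entropy n) (∑ x, l x) ?_
  filter_upwards [S.ae_prior_mem] with θ hθ
  rw [Real.norm_of_nonneg (entropy_nonneg (interior_subset hθ) n)]
  exact entropy_le (interior_subset hθ) n hl

theorem integrable_redundancy (hS : S.Regular) (n : ℕ) (l : (Fin n → 𝒳) → ℝ) :
    Integrable (S.redundancy n l) S.prior :=
  (integrable_finsetSum _ fun x _ => (hS.integrable_prob n x).mul_const _).sub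
    (hS.integrable_entropy n)

/-- Only the mixture probabilities weight `l`, so finding the best average code reduces to Gibbs'
inequality for the mixture. -/
theorem integral_redundancy (hS : S.Regular) (n : ℕ) (l : (Fin n → 𝒳) → ℝ) :
    ∫ θ, S.redundancy n l θ ∂S.prior =
      ∑ x, (∫ θ, S.prob n θ x ∂S.prior) * l x - ∫ θ, S.entropy n θ ∂S.prior := by
  have hi : ∀ x ∈ Finset.univ, Integrable (fun θ => S.prob n θ x * l x) S.prior :=
    fun x _ => (hS.integrable_prob n x).mul_const _
  simp only [redundancy]
  rw [integral_sub (integrable_finsetSum _ hi) (hS.integrable_entropy n), integral_finsetSum _ hi]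
  simp only [integral_mul_const]

theorem sum_integral_prob (hS : S.Regular) (n : ℕ) :
    ∑ x, ∫ θ, S.prob n θ x ∂S.prior = 1 := by
  have := hS.isProbabilityMeasure_prior
  rw [← integral_finsetSum _ fun x _ => hS.integrable_prob n x]
  rw [integral_congr_ae (g := fun _ => 1)
    (S.ae_prior_mem.mono fun θ hθ => sum_prob (interior_subset hθ) n)]
  simp

/-- The ideal code for the Bayes mixture has the least average redundancy. -/
theorem integral_redundancy_mixture_le (hS : S.Regular) {n : ℕ} {l : (Fin n → 𝒳) → ℝ}
    (hl : l ∈ lengths 𝒳 n) :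
    ∫ θ, S.redundancy n (fun x => Real.logb 2 (1 / ∫ φ, S.prob n φ x ∂S.prior)) θ ∂S.prior ≤
      ∫ θ, S.redundancy n l θ ∂S.prior := by
  rw [hS.integral_redundancy, hS.integral_redundancy]
  exact sub_le_sub_right (sum_mul_logb_inv_le_of_kraft
    (fun x => integral_nonneg fun θ => S.prob_nonneg n θ x) (hS.sum_integral_prob n) hl.2) _

end Regular
end ParametricSource
end

/-! ### Consistency of the estimator and divergence of the average redundancy -/

noncomputable section

/-- A continuous cutoff which vanishes on the ball of radius `R` and is `1` off the ball of radius
`R + 1`. -/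
def normCutoff (E : Type*) [NormedAddCommGroup E] (R : ℝ) : E →ᵇ ℝ :=
  BoundedContinuousFunction.ofNormedAddCommGroup (fun v => min 1 (max 0 (‖v‖ - R)))
    (by fun_prop) 1 fun v => by
      rw [Real.norm_of_nonneg (le_min zero_le_one (le_max_left _ _))]
      exact min_le_left _ _

section Cutoff

variable {E : Type*} [NormedAddCommGroup E]

theorem normCutoff_nonneg (R : ℝ) (v : E) : 0 ≤ normCutoff E R v :=
  le_min zero_le_one (le_max_left _ _)

theorem normCutoff_eq_one {R : ℝ} {v : E} (h : R + 1 ≤ ‖v‖) : normCutoff E R v = 1 :=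
  min_eq_left (le_max_of_le_right (by linarith))

theorem normCutoff_eq_zero {R : ℝ} {v : E} (h : ‖v‖ ≤ R) : normCutoff E R v = 0 := by
  change min 1 (max 0 (‖v‖ - R)) = 0
  rw [max_eq_left (by linarith), min_eq_right zero_le_one]

theorem tendsto_integral_normCutoff [MeasurableSpace E] [OpensMeasurableSpace E]
    [SecondCountableTopology E] (G : Measure E) [IsFiniteMeasure G] :
    Tendsto (fun R : ℕ => ∫ v, normCutoff E R v ∂G) atTop (𝓝 0) := by
  rw [← integral_zero E ℝ (μ := G)]
  refine tendsto_integral_of_dominated_convergence (fun _ => 1)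
    (fun R => (normCutoff E R).continuous.aestronglyMeasurable) (integrable_const 1)
    (fun R => .of_forall fun v => ?_) (.of_forall fun v => ?_)
  · rw [Real.norm_of_nonneg (normCutoff_nonneg _ v)]
    exact min_le_left _ _
  · obtain ⟨N, hN⟩ := exists_nat_ge ‖v‖
    refine tendsto_const_nhds.congr' ?_
    filter_upwards [eventually_ge_atTop N] with R hR
    exact (normCutoff_eq_zero (hN.trans (by exact_mod_cast hR))).symm

end Cutoff

namespace ParametricSource

variable {d : ℕ} {𝒳 : Type*} [MeasurableSpace 𝒳] {S : ParametricSource d 𝒳}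
variable [Fintype 𝒳]

open Classical in
/-- The probability that the estimator `T` is off by at least `δ`. -/
def errorProb (S : ParametricSource d 𝒳) (n : ℕ) (T : (Fin n → 𝒳) → EuclideanSpace ℝ (Fin d))
    (δ : ℝ) (θ : EuclideanSpace ℝ (Fin d)) : ℝ :=
  ∑ x : Fin n → 𝒳, if δ ≤ dist (T x) θ then S.prob n θ x else 0

theorem errorProb_nonneg (S : ParametricSource d 𝒳) (n : ℕ)
    (T : (Fin n → 𝒳) → EuclideanSpace ℝ (Fin d)) (δ : ℝ) (θ : EuclideanSpace ℝ (Fin d)) :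
    0 ≤ S.errorProb n T δ θ := by
  refine Finset.sum_nonneg fun x _ => ?_
  split_ifs
  exacts [S.prob_nonneg n θ x, le_rfl]

/-- An estimator with `√n (T(Xⁿ) - θ)` convergent in distribution is consistent. -/
theorem tendsto_errorProb {T : (n : ℕ) → (Fin n → 𝒳) → EuclideanSpace ℝ (Fin d)}
    {θ : EuclideanSpace ℝ (Fin d)} {G : Measure (EuclideanSpace ℝ (Fin d))} [IsFiniteMeasure G]
    (h : ∀ f : EuclideanSpace ℝ (Fin d) →ᵇ ℝ,
      Tendsto (fun n : ℕ => ∑ x : Fin n → 𝒳, S.prob n θ x * f (√(n : ℝ) • (T n x - θ))) atTop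
        (𝓝 (∫ v, f v ∂G))) {δ : ℝ} (hδ : 0 < δ) :
    Tendsto (fun n => S.errorProb n (T n) δ θ) atTop (𝓝 0) := by
  refine tendsto_order.2 ⟨fun a ha => .of_forall fun n => ha.trans_le (S.errorProb_nonneg _ _ _ _),
    fun ε hε => ?_⟩
  -- Choose `R` so that the limit law has little mass beyond it. Once `√n δ ≥ R + 1`, an error of at
  -- least `δ` puts the rescaled error where the cutoff equals 1.
  obtain ⟨R, hR⟩ := ((tendsto_integral_normCutoff G).eventually (gt_mem_nhds hε)).exists
  have hsqrt : Tendsto (fun n : ℕ => √(n : ℝ) * δ) atTop atTop :=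
    (Real.tendsto_sqrt_atTop.comp tendsto_natCast_atTop_atTop).atTop_mul_const hδ
  filter_upwards [(h _).eventually (gt_mem_nhds hR), hsqrt.eventually_ge_atTop (R + 1 : ℝ)]
    with n hn hn'
  refine lt_of_le_of_lt (Finset.sum_le_sum fun x _ => ?_) hn
  have h0 := S.prob_nonneg n θ x
  split_ifs with hx
  · rw [normCutoff_eq_one, mul_one]
    rw [norm_smul, Real.norm_of_nonneg (Real.sqrt_nonneg _), ← dist_eq_norm]
    exact hn'.trans (mul_le_mul_of_nonneg_left hx (Real.sqrt_nonneg _))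
  · exact mul_nonneg h0 (normCutoff_nonneg _ _)

variable [DiscreteMeasurableSpace 𝒳]

theorem errorProb_le_one (n : ℕ) (T : (Fin n → 𝒳) → EuclideanSpace ℝ (Fin d)) (δ : ℝ)
    {θ : EuclideanSpace ℝ (Fin d)} (hθ : θ ∈ S.Θ) : S.errorProb n T δ θ ≤ 1 := by
  rw [← sum_prob hθ n]
  refine Finset.sum_le_sum fun x _ => ?_
  split_ifs
  exacts [le_rfl, S.prob_nonneg n θ x]

namespace Regular

theorem aestronglyMeasurable_errorProb (hS : S.Regular) (n : ℕ)
    (T : (Fin n → 𝒳) → EuclideanSpace ℝ (Fin d)) (δ : ℝ) :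
    AEStronglyMeasurable (S.errorProb n T δ) S.prior := by
  classical
  refine Finset.aestronglyMeasurable_fun_sum _ fun x _ => ?_
  have hm : MeasurableSet {θ | δ ≤ dist (T x) θ} :=
    (isClosed_le continuous_const (by fun_prop)).measurableSet
  refine ((hS.aestronglyMeasurable_prob n x).indicator hm).congr (.of_forall fun θ => ?_)
  simp [Set.indicator_apply]

theorem integrable_errorProb (hS : S.Regular) (n : ℕ)
    (T : (Fin n → 𝒳) → EuclideanSpace ℝ (Fin d)) (δ : ℝ) :
    Integrable (S.errorProb n T δ) S.prior := by
  have := hS.isProbabilityMeasure_prior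
  refine .of_bound (hS.aestronglyMeasurable_errorProb n T δ) 1 ?_
  filter_upwards [S.ae_prior_mem] with θ hθ
  rw [Real.norm_of_nonneg (S.errorProb_nonneg n T δ θ)]
  exact errorProb_le_one n T δ (interior_subset hθ)

theorem tendsto_integral_errorProb (hS : S.Regular)
    {T : (n : ℕ) → (Fin n → 𝒳) → EuclideanSpace ℝ (Fin d)} {δ : ℝ}
    (hT : ∀ θ ∈ interior S.Θ, Tendsto (fun n => S.errorProb n (T n) δ θ) atTop (𝓝 0)) :
    Tendsto (fun n => ∫ θ, S.errorProb n (T n) δ θ ∂S.prior) atTop (𝓝 0) := by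
  have := hS.isProbabilityMeasure_prior
  rw [← integral_zero (EuclideanSpace ℝ (Fin d)) ℝ (μ := S.prior)]
  refine tendsto_integral_of_dominated_convergence (fun _ => 1)
    (fun n => hS.aestronglyMeasurable_errorProb n (T n) δ) (integrable_const 1) (fun n => ?_)
    (S.ae_prior_mem.mono hT)
  filter_upwards [S.ae_prior_mem] with θ hθ
  rw [Real.norm_of_nonneg (S.errorProb_nonneg n _ δ θ)]
  exact errorProb_le_one n _ δ (interior_subset hθ)

open Classical in
/-- Under the Bayes mixture, the estimator is close to `θ` with little more than the prior
probability of a ball around `θ`. -/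
theorem sum_integral_prob_close_le (hS : S.Regular) (n : ℕ)
    (T : (Fin n → 𝒳) → EuclideanSpace ℝ (Fin d)) (δ : ℝ) (θ : EuclideanSpace ℝ (Fin d)) :
    ∑ x with dist (T x) θ < δ, ∫ φ, S.prob n φ x ∂S.prior ≤
      S.prior.real (Metric.closedBall θ (2 * δ)) + ∫ φ, S.errorProb n T δ φ ∂S.prior := by
  have := hS.isProbabilityMeasure_prior
  have hb : MeasurableSet (Metric.closedBall θ (2 * δ)) := Metric.isClosed_closedBall.measurableSet
  have hind : Integrable
      ((Metric.closedBall θ (2 * δ)).indicator (1 : EuclideanSpace ℝ (Fin d) → ℝ)) S.prior :=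
    (integrable_const (1 : ℝ)).indicator hb
  rw [← integral_finsetSum _ fun x _ => hS.integrable_prob n x, ← integral_indicator_one hb,
    ← integral_add hind (hS.integrable_errorProb n T δ)]
  refine integral_mono_ae (integrable_finsetSum _ fun x _ => hS.integrable_prob n x)
    (hind.add (hS.integrable_errorProb n T δ)) ?_
  filter_upwards [S.ae_prior_mem] with φ hφ
  -- For `φ` in the ball the sum is at most 1. For `φ` farther than `2δ` from `θ`, an estimate
  -- within `δ` of `θ` is off by at least `δ` from `φ`.
  by_cases hφθ : φ ∈ Metric.closedBall θ (2 * δ)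
  · rw [Set.indicator_of_mem hφθ, Pi.one_apply, ← sum_prob (interior_subset hφ) n]
    refine le_add_of_le_of_nonneg ?_ (S.errorProb_nonneg n T δ φ)
    exact Finset.sum_le_sum_of_subset_of_nonneg (Finset.subset_univ _)
      fun x _ _ => S.prob_nonneg n φ x
  · rw [Set.indicator_of_notMem hφθ, zero_add, errorProb, Finset.sum_filter]
    refine Finset.sum_le_sum fun x _ => ?_
    have h0 := S.prob_nonneg n φ x
    rw [Metric.mem_closedBall, not_le] at hφθ
    split_ifs with h₁ h₂
    · exact le_rfl
    · have := dist_triangle_left φ θ (T x)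
      linarith
    · exact h0
    · exact le_rfl

/-- Supplies the absolute continuity that Gibbs' inequality needs, for all of the countably many
strings at once. -/
theorem ae_prob_eq_zero (hS : S.Regular) :
    ∀ᵐ θ ∂S.prior, ∀ (n : ℕ) (x : Fin n → 𝒳),
      ∫ φ, S.prob n φ x ∂S.prior = 0 → S.prob n θ x = 0 := by
  refine ae_all_iff.2 fun n => ae_all_iff.2 fun x => ?_
  by_cases h : ∫ φ, S.prob n φ x ∂S.prior = 0
  · filter_upwards [(integral_eq_zero_iff_of_nonneg (fun θ => S.prob_nonneg n θ x)
      (hS.integrable_prob n x)).1 h] with θ hθ _ using hθ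
  · exact .of_forall fun θ h' => absurd h' h

theorem exists_prior_closedBall_lt (hS : S.Regular) (hd : 1 ≤ d) (θ : EuclideanSpace ℝ (Fin d))
    {ε : ℝ} (hε : 0 < ε) : ∃ δ > 0, S.prior.real (Metric.closedBall θ (2 * δ)) < ε := by
  have := hS.isProbabilityMeasure_prior
  obtain ⟨U, hU, hUo, hUε⟩ := Set.exists_isOpen_lt_of_lt {θ} (ENNReal.ofReal ε) (μ := S.prior)
    (by rw [prior_singleton hd]; exact ENNReal.ofReal_pos.2 hε)
  obtain ⟨r, hr, hrU⟩ := Metric.nhds_basis_closedBall.mem_iff.1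
    (hUo.mem_nhds (hU (Set.mem_singleton θ)))
  refine ⟨r / 2, half_pos hr, ?_⟩
  rw [mul_div_cancel₀ _ two_ne_zero]
  exact ENNReal.toReal_lt_of_lt_ofReal ((measure_mono hrU).trans_lt hUε)

theorem tendsto_redundancy_mixture (hS : S.Regular) (hd : 1 ≤ d)
    {θ : EuclideanSpace ℝ (Fin d)} (hθ : θ ∈ interior S.Θ)
    (hθ0 : ∀ (n : ℕ) (x : Fin n → 𝒳), ∫ φ, S.prob n φ x ∂S.prior = 0 → S.prob n θ x = 0) :
    Tendsto (fun n => S.redundancy n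
      (fun x => Real.logb 2 (1 / ∫ φ, S.prob n φ x ∂S.prior)) θ) atTop atTop := by
  classical
  obtain ⟨T, -, hclt⟩ := hS.clt
  refine tendsto_atTop.2 fun K => ?_
  -- Chosen so that `(1 / 2) * logb 2 (1 / ε) - 1 = |K|`; the factor 1/2 bounds from below the
  -- probability that the estimator is close.
  set ε : ℝ := 2 ^ (-(2 * (|K| + 1))) with hε_def
  have hε : 0 < ε := Real.rpow_pos_of_pos two_pos _
  obtain ⟨δ, hδ, hball⟩ := hS.exists_prior_closedBall_lt hd θ (half_pos hε)
  have hT : ∀ φ ∈ interior S.Θ, Tendsto (fun n => S.errorProb n (T n) δ φ) atTop (𝓝 0) :=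
    fun φ hφ => tendsto_errorProb (hclt φ hφ) hδ
  filter_upwards [(hT θ hθ).eventually (gt_mem_nhds one_half_pos),
    (hS.tendsto_integral_errorProb hT).eventually (gt_mem_nhds (half_pos hε))] with n hn hn'
  have hA := hS.sum_integral_prob_close_le n (T n) δ θ
  have hkey := mul_logb_inv_sub_one_le (S.prob_nonneg n θ)
    (fun x => integral_nonneg fun φ => S.prob_nonneg n φ x) (sum_prob (interior_subset hθ) n)
    (hS.sum_integral_prob n).le (hθ0 n) _ hε (hA.trans (by linarith))
  refine le_trans ?_ hkey
  have hP : 1 / 2 ≤ ∑ x with dist (T n x) θ < δ, S.prob n θ x := by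
    have h := Finset.sum_filter_add_sum_filter_not Finset.univ (fun x => dist (T n x) θ < δ)
      (S.prob n θ)
    rw [sum_prob (interior_subset hθ) n] at h
    simp only [not_lt] at h
    rw [errorProb, ← Finset.sum_filter] at hn
    linarith
  have hlog : Real.logb 2 (1 / ε) = 2 * (|K| + 1) := by
    rw [one_div, hε_def, ← Real.rpow_neg two_pos.le, neg_neg,
      Real.logb_rpow two_pos (by norm_num)]
  rw [hlog]
  nlinarith [abs_nonneg K, le_abs_self K]

theorem tendsto_integral_redundancy_mixture (hS : S.Regular) (hd : 1 ≤ d) :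
    Tendsto (fun n => ∫ θ, S.redundancy n
      (fun x => Real.logb 2 (1 / ∫ φ, S.prob n φ x ∂S.prior)) θ ∂S.prior) atTop atTop := by
  have := hS.isProbabilityMeasure_prior
  set F : ℕ → EuclideanSpace ℝ (Fin d) → ℝ := fun n =>
    S.redundancy n fun x => Real.logb 2 (1 / ∫ φ, S.prob n φ x ∂S.prior)
  have hF : ∀ n, Integrable (F n) S.prior := fun n => hS.integrable_redundancy n _
  have hF0 : ∀ n, 0 ≤ᵐ[S.prior] F n := fun n => by
    filter_upwards [S.ae_prior_mem, hS.ae_prob_eq_zero] with θ hθ hθ0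
    exact sub_nonneg.2 (sum_mul_logb_inv_le (S.prob_nonneg n θ)
      (fun x => integral_nonneg fun φ => S.prob_nonneg n φ x) (sum_prob (interior_subset hθ) n)
      (hS.sum_integral_prob n).le (hθ0 n))
  have hlim : ∀ᵐ θ ∂S.prior, liminf (fun n => ENNReal.ofReal (F n θ)) atTop = ⊤ := by
    filter_upwards [S.ae_prior_mem, hS.ae_prob_eq_zero] with θ hθ hθ0
    exact (ENNReal.tendsto_ofReal_atTop.comp
      (hS.tendsto_redundancy_mixture hd hθ hθ0)).liminf_eq
  -- Fatou's lemma in `[0, ∞]`: the divergences are nonnegative almost everywhere and their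
  -- pointwise liminf is infinite on a set of full measure.
  have hfatou := lintegral_liminf_le' (u := atTop)
    fun n => (hF n).aestronglyMeasurable.aemeasurable.ennreal_ofReal
  rw [lintegral_congr_ae hlim, lintegral_const, measure_univ, mul_one, top_le_iff] at hfatou
  refine tendsto_atTop.2 fun K => ?_
  have hK : ENNReal.ofReal K <
      liminf (fun n => ∫⁻ θ, ENNReal.ofReal (F n θ) ∂S.prior) atTop := by
    rw [hfatou]
    exact ENNReal.ofReal_lt_top
  filter_upwards [eventually_lt_of_lt_liminf hK] with n hn
  rw [← ofReal_integral_eq_lintegral_ofReal (hF n) (hF0 n)] at hn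
  exact (ENNReal.ofReal_lt_ofReal_iff'.1 hn).1.le

theorem tendsto_avgRedundancy (hS : S.Regular) (hd : 1 ≤ d) :
    Tendsto (fun n => S.avgRedundancy n) atTop atTop := by
  refine tendsto_atTop_mono (fun n => ?_) (hS.tendsto_integral_redundancy_mixture hd)
  have : Nonempty (lengths 𝒳 n) := (S.nonempty_lengths n).to_subtype
  exact le_ciInf fun l => hS.integral_redundancy_mixture_le l.2

end Regular
end ParametricSource
end

/-! ### The joint prior and the bounded saving from side information -/

noncomputable section
namespace ParametricSource

variable {d : ℕ} {𝒳 : Type*} [MeasurableSpace 𝒳] {S : ParametricSource d 𝒳}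
variable [Fintype 𝒳] [DiscreteMeasurableSpace 𝒳]

namespace Regular

theorem mixture_ne_top (hS : S.Regular) (t : ℕ) (z : Fin t → 𝒳) : S.mixture t z ≠ ⊤ := by
  have := hS.isProbabilityMeasure_prior
  refine ne_top_of_le_ne_top ENNReal.one_ne_top (?_ : S.mixture t z ≤ 1)
  calc S.mixture t z ≤ ∫⁻ _, 1 ∂S.prior := by
        refine lintegral_mono_ae ?_
        filter_upwards [S.ae_prior_mem] with θ hθ
        exact ENNReal.ofReal_le_one.2 (prob_le_one (interior_subset hθ) t z)
    _ = 1 := by simp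

/-- Bayes' rule without division. It also covers a string `z` of mixture probability zero, whose
posterior is meaningless: both sides then vanish. -/
theorem mixture_smul_posterior (hS : S.Regular) (t : ℕ) (z : Fin t → 𝒳) :
    S.mixture t z • S.posterior t z =
      S.prior.withDensity fun θ => ENNReal.ofReal (S.prob t θ z) := by
  by_cases h0 : S.mixture t z = 0
  · rw [h0, zero_smul, eq_comm, ← Measure.measure_univ_eq_zero,
      withDensity_apply _ MeasurableSet.univ, Measure.restrict_univ]
    exact h0
  · rw [posterior, smul_smul, ENNReal.mul_inv_cancel h0 (hS.mixture_ne_top t z), one_smul]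

theorem isProbabilityMeasure_posterior (hS : S.Regular) {t : ℕ} {z : Fin t → 𝒳}
    (h0 : S.mixture t z ≠ 0) : IsProbabilityMeasure (S.posterior t z) := by
  constructor
  rw [posterior, Measure.smul_apply, withDensity_apply _ MeasurableSet.univ, Measure.restrict_univ]
  exact ENNReal.inv_mul_cancel h0 (hS.mixture_ne_top t z)

theorem sum_mixture_smul_posterior (hS : S.Regular) (t : ℕ) :
    ∑ z, S.mixture t z • S.posterior t z = S.prior := by
  ext s hs
  simp only [hS.mixture_smul_posterior, Measure.finsetSum_apply, withDensity_apply _ hs]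
  rw [← lintegral_finsetSum' _ fun z _ =>
    (hS.aestronglyMeasurable_prob t z).aemeasurable.ennreal_ofReal.restrict]
  rw [lintegral_congr_ae (g := fun _ => 1), setLIntegral_one]
  refine ae_restrict_of_ae ?_
  filter_upwards [S.ae_prior_mem] with θ hθ
  rw [← ENNReal.ofReal_sum_of_nonneg fun z _ => S.prob_nonneg t θ z,
    sum_prob (interior_subset hθ) t, ENNReal.ofReal_one]

/-- Given `Z^t`, each coordinate follows the posterior, and the posteriors average to the prior. A
general `π` treats both coordinates together; strings of mixture probability zero carry no weight.
-/
theorem map_jointPrior (hS : S.Regular) (t : ℕ)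
    {π : EuclideanSpace ℝ (Fin d) × EuclideanSpace ℝ (Fin d) → EuclideanSpace ℝ (Fin d)}
    (hπ : Measurable π)
    (h : ∀ μ : Measure (EuclideanSpace ℝ (Fin d)), IsProbabilityMeasure μ →
      (μ.prod μ).map π = μ) :
    MeasurePreserving π (S.jointPrior t) S.prior := by
  refine ⟨hπ, ?_⟩
  rw [← hS.sum_mixture_smul_posterior t, jointPrior]
  ext s hs
  rw [Measure.map_apply hπ hs, Measure.finsetSum_apply, Measure.finsetSum_apply]
  refine Finset.sum_congr rfl fun z _ => ?_
  by_cases h0 : S.mixture t z = 0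
  · simp [h0]
  · rw [Measure.smul_apply, Measure.smul_apply, ← Measure.map_apply hπ hs,
      h _ (hS.isProbabilityMeasure_posterior h0)]

theorem measurePreserving_fst (hS : S.Regular) (t : ℕ) :
    MeasurePreserving Prod.fst (S.jointPrior t) S.prior :=
  hS.map_jointPrior t measurable_fst fun μ _ => by simp [Measure.map_fst_prod]

theorem measurePreserving_snd (hS : S.Regular) (t : ℕ) :
    MeasurePreserving Prod.snd (S.jointPrior t) S.prior :=
  hS.map_jointPrior t measurable_snd fun μ _ => by simp [Measure.map_snd_prod]

theorem ae_jointPrior_mem (hS : S.Regular) (t : ℕ) :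
    ∀ᵐ p ∂S.jointPrior t, p.1 ∈ S.Θ ∧ p.2 ∈ S.Θ :=
  (((hS.measurePreserving_fst t).quasiMeasurePreserving.ae S.ae_prior_mem).and
    ((hS.measurePreserving_snd t).quasiMeasurePreserving.ae S.ae_prior_mem)).mono
    fun _ hp => ⟨interior_subset hp.1, interior_subset hp.2⟩

theorem integrable_redundancy_fst (hS : S.Regular) (n t : ℕ) (l : (Fin n → 𝒳) → ℝ) :
    Integrable (fun p => S.redundancy n l p.1) (S.jointPrior t) :=
  (hS.measurePreserving_fst t).integrable_comp_of_integrable (hS.integrable_redundancy n l)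

theorem integral_redundancy_fst (hS : S.Regular) (n t : ℕ) (l : (Fin n → 𝒳) → ℝ) :
    ∫ p, S.redundancy n l p.1 ∂S.jointPrior t = ∫ θ, S.redundancy n l θ ∂S.prior := by
  have h := (hS.measurePreserving_fst t).map_eq
  rw [← h, integral_map measurable_fst.aemeasurable]
  rw [h]
  exact (hS.integrable_redundancy n l).aestronglyMeasurable

theorem isProbabilityMeasure_jointPrior (hS : S.Regular) (t : ℕ) :
    IsProbabilityMeasure (S.jointPrior t) := by
  have := hS.isProbabilityMeasure_prior
  have h := (hS.measurePreserving_fst t).measure_preimage MeasurableSet.univ.nullMeasurableSet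
  exact ⟨by simpa using h⟩

theorem integrable_redundancyED (hS : S.Regular) (n m t : ℕ)
    (l : (Fin n → 𝒳) → (Fin m → 𝒳) → ℝ) :
    Integrable (fun p => S.redundancyED n m l p.1 p.2) (S.jointPrior t) := by
  have := hS.isProbabilityMeasure_jointPrior t
  refine (integrable_finsetSum _ fun x _ => integrable_finsetSum _ fun y _ =>
    Integrable.mul_const ?_ _).sub
    ((hS.measurePreserving_fst t).integrable_comp_of_integrable (hS.integrable_entropy n))
  refine .of_bound (((hS.aestronglyMeasurable_prob n x).comp_measurePreserving
    (hS.measurePreserving_fst t)).mul ((hS.aestronglyMeasurable_prob m y).comp_measurePreserving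
    (hS.measurePreserving_snd t))) 1 ?_
  filter_upwards [hS.ae_jointPrior_mem t] with p hp
  change ‖S.prob n p.1 x * S.prob m p.2 y‖ ≤ 1
  rw [Real.norm_of_nonneg (mul_nonneg (S.prob_nonneg _ _ _) (S.prob_nonneg _ _ _))]
  exact mul_le_one₀ (prob_le_one hp.1 n x) (S.prob_nonneg _ _ _) (prob_le_one hp.2 m y)

end Regular

theorem redundancyED_const {n m : ℕ} (l : (Fin n → 𝒳) → ℝ) (θ₁ : EuclideanSpace ℝ (Fin d))
    {θ₂ : EuclideanSpace ℝ (Fin d)} (hθ₂ : θ₂ ∈ S.Θ) :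
    S.redundancyED n m (fun x _ => l x) θ₁ θ₂ = S.redundancy n l θ₁ := by
  rw [redundancyED, redundancy]
  congr 1
  refine Finset.sum_congr rfl fun x _ => ?_
  rw [← Finset.sum_mul, ← Finset.mul_sum, sum_prob hθ₂, mul_one]

/-- A code with side information is at most `log |𝒳^m|` bits better than a code without, that is
obtained by averaging the corresponding subprobabilities over the side information. -/
theorem exists_lengths_le_add [Nonempty 𝒳] {n m : ℕ} {l : (Fin n → 𝒳) → (Fin m → 𝒳) → ℝ}
    (hl : l ∈ lengthsED 𝒳 n m) :
    ∃ l' ∈ lengths 𝒳 n, ∀ x y, l' x ≤ l x y + Real.logb 2 (Fintype.card (Fin m → 𝒳)) := by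
  set N : ℝ := ((Fintype.card (Fin m → 𝒳) : ℕ) : ℝ)
  have hN : 0 < N := Nat.cast_pos.2 Fintype.card_pos
  have hcard : ∑ _y : Fin m → 𝒳, (1 : ℝ) = N := by simp [N]
  have hsum : ∀ x, 0 < ∑ y, (2 : ℝ) ^ (-l x y) := fun x =>
    Finset.sum_pos (fun y _ => Real.rpow_pos_of_pos two_pos _) Finset.univ_nonempty
  -- The average over `y` keeps Kraft's inequality, and bounding the sum below by a single term
  -- costs only the factor `N`.
  refine ⟨fun x => -Real.logb 2 ((∑ y, (2 : ℝ) ^ (-l x y)) / N), ⟨fun x => ?_, ?_⟩, fun x y => ?_⟩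
  · rw [neg_nonneg]
    refine Real.logb_nonpos one_lt_two (div_pos (hsum x) hN).le ((div_le_one hN).2 ?_)
    rw [← hcard]
    exact Finset.sum_le_sum fun y _ =>
      Real.rpow_le_one_of_one_le_of_nonpos one_le_two (neg_nonpos.2 ((hl y).1 x))
  · simp only [neg_neg]
    rw [Finset.sum_congr rfl fun x _ => Real.rpow_logb two_pos (by norm_num) (div_pos (hsum x) hN),
      ← Finset.sum_div, Finset.sum_comm, div_le_one hN, ← hcard]
    exact Finset.sum_le_sum fun y _ => (hl y).2
  · have h : Real.logb 2 ((2 : ℝ) ^ (-l x y)) ≤ Real.logb 2 (∑ y, (2 : ℝ) ^ (-l x y)) :=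
      Real.logb_le_logb_of_le one_lt_two (Real.rpow_pos_of_pos two_pos _)
        (Finset.single_le_sum (f := fun y => (2 : ℝ) ^ (-l x y))
          (fun y _ => (Real.rpow_pos_of_pos two_pos _).le) (Finset.mem_univ y))
    rw [Real.logb_rpow two_pos (by norm_num)] at h
    beta_reduce
    rw [Real.logb_div (hsum x).ne' hN.ne']
    linarith

theorem redundancy_sub_le_redundancyED {n m : ℕ} {l : (Fin n → 𝒳) → (Fin m → 𝒳) → ℝ}
    {l' : (Fin n → 𝒳) → ℝ} {c : ℝ} (h : ∀ x y, l' x ≤ l x y + c)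
    {θ₁ θ₂ : EuclideanSpace ℝ (Fin d)} (hθ₁ : θ₁ ∈ S.Θ) (hθ₂ : θ₂ ∈ S.Θ) :
    S.redundancy n l' θ₁ - c ≤ S.redundancyED n m l θ₁ θ₂ := by
  have hconst : S.redundancy n l' θ₁ - c = S.redundancyED n m (fun x _ => l' x - c) θ₁ θ₂ := by
    rw [redundancyED_const (fun x => l' x - c) θ₁ hθ₂]
    simp only [redundancy, mul_sub, Finset.sum_sub_distrib, ← Finset.sum_mul, sum_prob hθ₁]
    ring
  rw [hconst]
  refine sub_le_sub_right (Finset.sum_le_sum fun x _ => Finset.sum_le_sum fun y _ => ?_) _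
  exact mul_le_mul_of_nonneg_left (sub_le_iff_le_add.2 (h x y))
    (mul_nonneg (S.prob_nonneg _ _ _) (S.prob_nonneg _ _ _))

theorem avgRedundancy_le_integral {n : ℕ} {l : (Fin n → 𝒳) → ℝ}
    (hl : l ∈ lengths 𝒳 n) : S.avgRedundancy n ≤ ∫ θ, S.redundancy n l θ ∂S.prior := by
  refine ciInf_le (f := fun l : lengths 𝒳 n => ∫ θ, S.redundancy n l θ ∂S.prior)
    ⟨0, ?_⟩ ⟨l, hl⟩
  rintro _ ⟨l, rfl⟩
  exact integral_nonneg_of_ae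
    (S.ae_prior_mem.mono fun θ hθ => redundancy_nonneg l.2 (interior_subset hθ))

namespace Regular

theorem avgRedundancy_sub_le_integral (hS : S.Regular) {n m : ℕ} (t : ℕ)
    {l : (Fin n → 𝒳) → (Fin m → 𝒳) → ℝ} (hl : l ∈ lengthsED 𝒳 n m) :
    S.avgRedundancy n - Real.logb 2 (Fintype.card (Fin m → 𝒳)) ≤
      ∫ p, S.redundancyED n m l p.1 p.2 ∂S.jointPrior t := by
  have := hS.isProbabilityMeasure_jointPrior t
  have := S.nonempty_alphabet
  obtain ⟨l', hl', hle⟩ := exists_lengths_le_add hl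
  calc S.avgRedundancy n - Real.logb 2 (Fintype.card (Fin m → 𝒳))
      ≤ ∫ θ, S.redundancy n l' θ ∂S.prior - Real.logb 2 (Fintype.card (Fin m → 𝒳)) :=
        sub_le_sub_right (avgRedundancy_le_integral hl') _
    _ = ∫ p, (S.redundancy n l' p.1 - Real.logb 2 (Fintype.card (Fin m → 𝒳)))
          ∂S.jointPrior t := by
        rw [integral_sub (hS.integrable_redundancy_fst n t l') (integrable_const _),
          hS.integral_redundancy_fst]
        simp
    _ ≤ _ := by
        refine integral_mono_ae ((hS.integrable_redundancy_fst n t l').sub (integrable_const _))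
          (hS.integrable_redundancyED n m t l) ?_
        filter_upwards [hS.ae_jointPrior_mem t] with p hp
        exact redundancy_sub_le_redundancyED hle hp.1 hp.2

theorem avgRedundancy_sub_le (hS : S.Regular) (n m t : ℕ) :
    S.avgRedundancy n - Real.logb 2 (Fintype.card (Fin m → 𝒳)) ≤ S.avgRedundancyED n m t := by
  obtain ⟨l, hl⟩ := S.nonempty_lengths n
  have : Nonempty (lengthsED 𝒳 n m) := ⟨⟨fun x _ => l x, fun _ => hl⟩⟩
  exact le_ciInf fun l => hS.avgRedundancy_sub_le_integral t l.2

theorem avgRedundancyED_le (hS : S.Regular) (n m t : ℕ) :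
    S.avgRedundancyED n m t ≤ S.avgRedundancy n := by
  have : Nonempty (lengths 𝒳 n) := (S.nonempty_lengths n).to_subtype
  refine le_ciInf fun l => ?_
  -- A real infimum is meaningful only if bounded below; the bounded-saving estimate provides the
  -- bound, and the code ignoring `y` is the competitor.
  refine (ciInf_le (f := fun l : lengthsED 𝒳 n m =>
    ∫ p, S.redundancyED n m l p.1 p.2 ∂S.jointPrior t)
    ⟨S.avgRedundancy n - Real.logb 2 (Fintype.card (Fin m → 𝒳)), ?_⟩
    ⟨fun x _ => l.1 x, fun _ => l.2⟩).trans_eq ?_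
  · rintro _ ⟨l, rfl⟩
    exact hS.avgRedundancy_sub_le_integral t l.2
  · rw [← hS.integral_redundancy_fst n t]
    exact integral_congr_ae
      ((hS.ae_jointPrior_mem t).mono fun p hp => redundancyED_const l.1 p.1 hp.2)

end Regular
end ParametricSource
end

/-! ### The limit of the gain -/

theorem tendsto_div_of_sub_bounded {a b : ℕ → ℝ} {c : ℝ} (ha : Filter.Tendsto a atTop atTop)
    (hba : ∀ n, b n ≤ a n) (hab : ∀ n, a n - c ≤ b n) :
    Filter.Tendsto (fun n => a n / b n) atTop (𝓝 1) := by
  have hb : Tendsto b atTop atTop :=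
    tendsto_atTop_mono hab (tendsto_atTop_add_const_right _ (-c) ha)
  have hlim : Tendsto (fun n => 1 + c / b n) atTop (𝓝 1) := by
    simpa using (hb.const_div_atTop c).const_add 1
  refine tendsto_of_tendsto_of_tendsto_of_le_of_le' tendsto_const_nhds hlim ?_ ?_
  · filter_upwards [hb.eventually_gt_atTop 0] with n hn
    exact (one_le_div hn).2 (hba n)
  · filter_upwards [hb.eventually_gt_atTop 0] with n hn
    rw [div_le_iff₀ hn, add_mul, div_mul_cancel₀ _ hn.ne']
    linarith [hab n]

theorem mainTheorem9 {d : ℕ} (hd : 1 ≤ d) {𝒳 : Type*} [Fintype 𝒳] [MeasurableSpace 𝒳]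
    [DiscreteMeasurableSpace 𝒳] (S : ParametricSource d 𝒳) (hS : S.Regular)
    (m t : ℕ) (θ : EuclideanSpace ℝ (Fin d)) (hθ : θ ∈ S.Θ) :
    Filter.Tendsto (fun n : ℕ => S.gain n m t θ) Filter.atTop (nhds 1) := by
  -- The entropy cancels in the difference of numerator and denominator, and being nonnegative it
  -- does not spoil the divergence.
  refine tendsto_div_of_sub_bounded (c := Real.logb 2 (Fintype.card (Fin m → 𝒳)))
    (tendsto_atTop_mono (fun n => ?_) (hS.tendsto_avgRedundancy hd))
    (fun n => ?_) (fun n => ?_)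
  · exact le_add_of_nonneg_left (ParametricSource.entropy_nonneg hθ n)
  · exact add_le_add_right (hS.avgRedundancyED_le n m t) _
  · linarith [hS.avgRedundancy_sub_le n m t]
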